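/- Let $\Sigma=(\Sigma_0,\Sigma_1,\Sigma_2)$ be a $2$-polygraph: a directed graph $(\Sigma_0,\Sigma_1)$ with a set $\Sigma_2$ of rules $\varphi:s\Rightarrow t$ between parallel $1$-cells of the free category $\Sigma_1^*$. Write $\Sigma_2^*$ (resp. $\Sigma_2^\top$) for the free $2$-category (resp. free $(2,1)$-category) on $\Sigma$; $\star_1$ is the vertical composition and juxtaposition the horizontal one. Rewriting steps are the $2$-cells $u\varphi v$ with $\varphi\in\Sigma_2$ and $u,v\in\Sigma_1^*$; rewriting sequences are the finite composable sequences of steps (possibly empty). Assume that $\Sigma$ is quasi-convergent, that is, confluent (any two rewriting sequences with the same source can be completed by rewriting sequences to a common target) and quasi-terminating (every infinite sequence $(u_n)_n$ of $1$-cells with a step from $u_n$ to $u_{n+1}$ for all $n$ contains some $1$-cell infinitely often). *Labelling.* A quasi-normal form is a $1$-cell $u$ such that for each step $u\Rightarrow v$ there is a rewriting sequence from $v$ to $u$. Fix for every $1$-cell $u$ a quasi-normal form $\widetilde u$ into which $u$ rewrites, with $\widetilde u=\widetilde v$ whenever $u$ and $v$ are equal in the category presented by $\Sigma$. The associated quasi-normal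 form labelling sends a step $f$ with target $v$ to $\psi^{\mathrm{QNF}}(f)=d(v,\widetilde v)\in\mathbb N$, the length of a shortest rewriting sequence from $v$ to $\widetilde v$. *Branchings.* A local branching is a pair $(f,g)$ of steps with the same source. It is aspherical if $f=g$; it is a Peiffer branching if, up to exchanging its two members, it is of the form $(fv,ug)$ with steps $f:u\Rightarrow u'$ and $g:v\Rightarrow v'$. A critical branching is a local branching, neither aspherical nor Peiffer, that is minimal for the order $(f,g)\sqsubseteq(wfw',wgw')$. A confluence diagram $(f\cdot f',g\cdot g')$ of $(f,g)$ consists of rewriting sequences $f'$, $g'$ from the targets of $f$, $g$ to a common target; it is strictly decreasing if every step of $f'$ has a label $<\psi^{\mathrm{QNF}}(f)$ and every step of $g'$ has a label $<\psi^{\mathrm{QNF}}(g)$. The labelling is compatible with contexts if, for every strictly decreasing confluence diagram $(f\cdot f',g\cdot g')$ of a local branching and all composable $1$-cells $u_1,u_2$, the diagram $(u_1fu_2\cdot u_1f'u_2,\,u_1gu_2\cdot u_1g'u_2)$ is strictly decreasing. *Loops.* A $2$-loop is a $2$-cell of $\Sigma_2^*$ with equal source and target. It is elementary if (i) $f=g\star_1h\star_1k$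 with $h$ a $2$-loop implies that $h$ is an identity or $h=f$, and (ii) $f=ugv$ with $g$ a $2$-loop and $u,v$ $1$-cells implies that $u$ and $v$ are both identities. Equivalence of $2$-loops is the equivalence relation generated by circular permutation of the steps in a decomposition into steps. *Completion.* A strictly decreasing Squier completion $\mathcal S^{sd}(\Sigma,\psi^{\mathrm{QNF}})$ is a $(3,1)$-polygraph extending $\Sigma$ by the following $3$-cells: for each critical branching $(f,g)$ (branchings being considered up to exchanging their two members; choosing a $3$-cell for both $(f,g)$ and $(g,f)$ is also allowed) one $3$-cell $f\star_1f'\Rrightarrow g\star_1g'$, where $(f\cdot f',g\cdot g')$ is a chosen strictly decreasing confluence diagram; and one $3$-cell $\alpha\Rrightarrow 1$ for one chosen elementary $2$-loop $\alpha$ in each equivalence class of elementary $2$-loops. Let $\mathcal S=\mathcal S^{sd}(\Sigma,\psi^{\mathrm{QNF}})$ be any such completion. Suppose that $\psi^{\mathrm{QNF}}$ is compatible with contexts and that $(\Sigma,\psi^{\mathrm{QNF}})$ is Peiffer decreasing with respect to $\mathcal S$: for all steps $f:u\Rightarrow u'$ and $g:v\Rightarrow v'$ with $u,v$ composable, there is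 a strictly decreasing confluence diagram $(fv\cdot f',ug\cdot g')$ of $(fv,ug)$ such that $u'g\star_1(fv')^-$ and $f'\star_1(g')^-$ are identified by the congruence on the $2$-cells of $\Sigma_2^\top$ generated by the $3$-cells of $\mathcal S$. Then $\mathcal S$ is a coherent presentation of the category presented by $\Sigma$ (the quotient of $\Sigma_1^*$ by the congruence generated by $\Sigma_2$): its underlying $2$-polygraph presents that category, and for every pair $(f,g)$ of parallel $2$-cells of $\Sigma_2^\top$ there is a $3$-cell from $f$ to $g$ in the free $(3,1)$-category generated by $\mathcal S$. -/

import Mathlib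

open CategoryTheory

universe u v w t

/-! ## Polygraphs and their 1-cells -/

/-- A 1-polygraph: a directed graph. -/
structure OnePolygraph where
  Obj : Type u
  Gen : Obj → Obj → Type v

namespace OnePolygraph

instance instQuiverObj (P : OnePolygraph.{u, v}) : Quiver.{v} P.Obj := ⟨P.Gen⟩

/-- The 1-cells of the free category on a 1-polygraph. -/
def OneCell (P : OnePolygraph.{u, v}) (x y : P.Obj) : Type (max u v) := Quiver.Path x y

namespace OneCell

variable {P : OnePolygraph.{u, v}} {x y z a b : P.Obj}

/-- The identity 1-cell. -/
def id (x : P.Obj) : P.OneCell x x := Quiver.Path.nil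

/-- The 0-composition of 1-cells. -/
def comp (p : P.OneCell x y) (q : P.OneCell y z) : P.OneCell x z := Quiver.Path.comp p q

theorem comp_assoc (p : P.OneCell x y) (q : P.OneCell y z) (r : P.OneCell z a) :
    (p.comp q).comp r = p.comp (q.comp r) := Quiver.Path.comp_assoc p q r

/-- The 1-cell `u p v`. -/
def ctx (u : P.OneCell x a) (p : P.OneCell a b) (v : P.OneCell b y) : P.OneCell x y :=
  (u.comp p).comp v

/-- The 1-cell `u` is an identity. -/
def IsIdentity (u : P.OneCell x y) : Prop := Quiver.Path.length u = 0

end OneCell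

end OnePolygraph

/-- A 2-polygraph: a 1-polygraph with a globular extension of its free category, given as the
family of the sets of 2-cells with prescribed (parallel) source and target. -/
structure TwoPolygraph extends OnePolygraph.{u, v} where
  Rule : ∀ {x y : Obj}, toOnePolygraph.OneCell x y → toOnePolygraph.OneCell x y → Type w

namespace TwoPolygraph

open OnePolygraph

variable {P : TwoPolygraph.{u, v, w}} {x y z a b : P.Obj}

/-! ## The presented category -/

/-- The relation on the free category given by the 2-cells. -/
def ruleRel (P : TwoPolygraph.{u, v, w}) : HomRel (Paths P.Obj) :=
  fun x y p q => Nonempty (P.Rule (x := x) (y := y) p q)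

/-- The category presented by `P`: the quotient of the free category by the congruence generated
by the 2-cells. -/
abbrev PresentedCategory (P : TwoPolygraph.{u, v, w}) := CategoryTheory.Quotient P.ruleRel

/-- Two 1-cells are congruent if they are equal in the presented category. -/
def Congruent (p q : P.OneCell x y) : Prop :=
  (CategoryTheory.Quotient.functor P.ruleRel).map (X := x) (Y := y) p =
    (CategoryTheory.Quotient.functor P.ruleRel).map (X := x) (Y := y) q

/-- `P` is a presentation of `C`: the category presented by `P` is isomorphic to `C`. -/
def IsPresentationOf (P : TwoPolygraph.{u, v, w}) (C : Type*) [Category* C] : Prop :=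
  ∃ (F : P.PresentedCategory ⥤ C) (G : C ⥤ P.PresentedCategory), F ⋙ G = 𝟭 _ ∧ G ⋙ F = 𝟭 _

/-! ## Rewriting steps and rewriting sequences -/

/-- A rewriting step `left rule right` from `p` to `q`. -/
structure Step (P : TwoPolygraph.{u, v, w}) {x y : P.Obj} (p q : P.OneCell x y) :
    Type (max u v w) where
  {c d : P.Obj}
  {s t : P.OneCell c d}
  left : P.OneCell x c
  rule : P.Rule s t
  right : P.OneCell d y
  source_eq : p = left.ctx s right
  target_eq : q = left.ctx t right

instance instQuiverOneCell : Quiver.{max u v w} (P.OneCell x y) := ⟨P.Step⟩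

namespace Step

/-- The rewriting step `u f`. -/
def whiskerLeft (u : P.OneCell x y) {p q : P.OneCell y z} (f : P.Step p q) :
    P.Step (u.comp p) (u.comp q) where
  left := u.comp f.left
  rule := f.rule
  right := f.right
  source_eq := by
    conv_lhs => rw [f.source_eq]
    simp only [OneCell.ctx, OneCell.comp_assoc]
  target_eq := by
    conv_lhs => rw [f.target_eq]
    simp only [OneCell.ctx, OneCell.comp_assoc]

/-- The rewriting step `f v`. -/
def whiskerRight {p q : P.OneCell x y} (f : P.Step p q) (v : P.OneCell y z) :
    P.Step (p.comp v) (q.comp v) where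
  left := f.left
  rule := f.rule
  right := f.right.comp v
  source_eq := by
    conv_lhs => rw [f.source_eq]
    simp only [OneCell.ctx, OneCell.comp_assoc]
  target_eq := by
    conv_lhs => rw [f.target_eq]
    simp only [OneCell.ctx, OneCell.comp_assoc]

/-- The rewriting step `u f v`. -/
def ctx (u : P.OneCell x a) {p q : P.OneCell a b} (f : P.Step p q) (v : P.OneCell b y) :
    P.Step (u.ctx p v) (u.ctx q v) :=
  (f.whiskerLeft u).whiskerRight v

end Step

/-- A (finite) rewriting sequence from `p` to `q`. -/
abbrev RewSeq (p q : P.OneCell x y) : Type (max u v w) := Quiver.Path p q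

/-- Steps of `P.OneCell a b` are sent to steps of `P.OneCell x y` by a context. -/
def ctxStep (u : P.OneCell x a) (v : P.OneCell b y) : P.OneCell a b ⥤q P.OneCell x y where
  obj p := u.ctx p v
  map f := Step.ctx u f v

/-- The rewriting sequence `u f v`. -/
def RewSeq.ctx (u : P.OneCell x a) {p q : P.OneCell a b} (f : RewSeq p q) (v : P.OneCell b y) :
    RewSeq (u.ctx p v) (u.ctx q v) :=
  (ctxStep u v).mapPath f

/-! ## The free 2-category and the free (2,1)-category

The hom-category of the free 2-category at `(x, y)` is the free category on the rewriting steps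
between the 1-cells from `x` to `y`, modulo the exchange relations
`f q ⋆₁ p' g = p g ⋆₁ f q'` for steps `f : p ⇒ p'` and `g : q ⇒ q'`; for the free (2,1)-category
one starts from the free groupoid on the rewriting steps. The composition `⋆₁` is written `≫`. -/

/-- The squares of rewriting steps that the exchange relations make commute. -/
inductive ExchangeSquare : ∀ {x y : P.Obj} {p q q' r : P.OneCell x y},
    P.Step p q → P.Step q r → P.Step p q' → P.Step q' r → Prop
  | mk {x y z : P.Obj} {p p' : P.OneCell x y} {q q' : P.OneCell y z}
      (f : P.Step p p') (g : P.Step q q') :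
      ExchangeSquare (f.whiskerRight q) (g.whiskerLeft p') (g.whiskerLeft p) (f.whiskerRight q')

theorem Step.heq_of_data {p q p' q' : P.OneCell x y} (hp : p = p') (hq : q = q')
    (f : P.Step p q) (l : P.OneCell x f.c) (r : P.OneCell f.d y) (hl : f.left = l)
    (hr : f.right = r) (h₁ : p' = l.ctx f.s r) (h₂ : q' = l.ctx f.t r) :
    f ≍ (⟨l, f.rule, r, h₁, h₂⟩ : P.Step p' q') := by
  subst hp hq hl hr
  rfl

theorem ExchangeSquare.of_heq {y : P.Obj} {p p' : P.OneCell x y} {q q' : P.OneCell y z}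
    (f : P.Step p p') (g : P.Step q q') {o o₁ o₂ o' : P.OneCell x z}
    (h : o = p.comp q) (h₁ : o₁ = p'.comp q) (h₂ : o₂ = p.comp q') (h' : o' = p'.comp q')
    {a : P.Step o o₁} {b : P.Step o₁ o'} {c : P.Step o o₂} {d : P.Step o₂ o'}
    (ha : a ≍ f.whiskerRight q) (hb : b ≍ g.whiskerLeft p')
    (hc : c ≍ g.whiskerLeft p) (hd : d ≍ f.whiskerRight q') : ExchangeSquare a b c d := by
  subst h h₁ h₂ h'
  obtain rfl := eq_of_heq ha
  obtain rfl := eq_of_heq hb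
  obtain rfl := eq_of_heq hc
  obtain rfl := eq_of_heq hd
  exact .mk f g

/-- Exchange squares are stable under contexts. -/
theorem ExchangeSquare.ctx (l : P.OneCell x a) (r : P.OneCell b y)
    {p q q' s : P.OneCell a b} {f : P.Step p q} {g : P.Step q s} {f' : P.Step p q'}
    {g' : P.Step q' s} (h : ExchangeSquare f g f' g') :
    ExchangeSquare (f.ctx l r) (g.ctx l r) (f'.ctx l r) (g'.ctx l r) := by
  cases h with
  | mk f g =>
    refine ExchangeSquare.of_heq (f.whiskerLeft l) (g.whiskerRight r) ?_ ?_ ?_ ?_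
      (Step.heq_of_data ?_ ?_ _ _ _ ?_ ?_ _ _) (Step.heq_of_data ?_ ?_ _ _ _ ?_ ?_ _ _)
      (Step.heq_of_data ?_ ?_ _ _ _ ?_ ?_ _ _) (Step.heq_of_data ?_ ?_ _ _ _ ?_ ?_ _ _) <;>
    simp only [OneCell.ctx, OneCell.comp_assoc, Step.ctx, Step.whiskerLeft, Step.whiskerRight]

/-- The exchange relations on rewriting sequences. -/
inductive Exchange (x y : P.Obj) : HomRel (Paths (P.OneCell x y))
  | mk {p q q' r : P.OneCell x y} {f : P.Step p q} {g : P.Step q r} {f' : P.Step p q'}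
      {g' : P.Step q' r} (h : ExchangeSquare f g f' g') :
      Exchange x y ((Paths.of (P.OneCell x y)).map f ≫ (Paths.of (P.OneCell x y)).map g)
        ((Paths.of (P.OneCell x y)).map f' ≫ (Paths.of (P.OneCell x y)).map g')

/-- The exchange relations on the free groupoid on rewriting steps. -/
inductive ExchangeGrpd (x y : P.Obj) : HomRel (Quiver.FreeGroupoid (P.OneCell x y))
  | mk {p q q' r : P.OneCell x y} {f : P.Step p q} {g : P.Step q r} {f' : P.Step p q'}
      {g' : P.Step q' r} (h : ExchangeSquare f g f' g') :
      ExchangeGrpd x y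
        ((Quiver.FreeGroupoid.of (P.OneCell x y)).map f ≫
          (Quiver.FreeGroupoid.of (P.OneCell x y)).map g)
        ((Quiver.FreeGroupoid.of (P.OneCell x y)).map f' ≫
          (Quiver.FreeGroupoid.of (P.OneCell x y)).map g')

/-- The hom-category at `(x, y)` of the free 2-category on `P`. -/
abbrev FreeTwo (P : TwoPolygraph.{u, v, w}) (x y : P.Obj) :=
  CategoryTheory.Quotient (Exchange (P := P) x y)

/-- The hom-groupoid at `(x, y)` of the free (2,1)-category on `P`. -/
abbrev FreeTwoOne (P : TwoPolygraph.{u, v, w}) (x y : P.Obj) :=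
  CategoryTheory.Quotient (ExchangeGrpd (P := P) x y)

/-- A rewriting step as a 2-cell of the free 2-category. -/
def stepTwo (x y : P.Obj) : P.OneCell x y ⥤q P.FreeTwo x y :=
  Paths.of (P.OneCell x y) ⋙q (CategoryTheory.Quotient.functor _).toPrefunctor

/-- A rewriting step as a 2-cell of the free (2,1)-category. -/
def stepTwoOne (x y : P.Obj) : P.OneCell x y ⥤q P.FreeTwoOne x y :=
  Quiver.FreeGroupoid.of (P.OneCell x y) ⋙q (CategoryTheory.Quotient.functor _).toPrefunctor

/-- The 2-cells of the free 2-category from `p` to `q`. -/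
abbrev TwoCell (p q : P.OneCell x y) := (stepTwo x y).obj p ⟶ (stepTwo x y).obj q

/-- The 2-cells of the free (2,1)-category from `p` to `q`. -/
abbrev TwoOneCell (p q : P.OneCell x y) := (stepTwoOne x y).obj p ⟶ (stepTwoOne x y).obj q

theorem stepTwo_exchange {p q q' r : P.OneCell x y} {f : P.Step p q} {g : P.Step q r}
    {f' : P.Step p q'} {g' : P.Step q' r} (h : ExchangeSquare f g f' g') :
    (stepTwo x y).map f ≫ (stepTwo x y).map g = (stepTwo x y).map f' ≫ (stepTwo x y).map g' :=
  CategoryTheory.Quotient.sound _ (Exchange.mk h)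

theorem stepTwoOne_exchange {p q q' r : P.OneCell x y} {f : P.Step p q} {g : P.Step q r}
    {f' : P.Step p q'} {g' : P.Step q' r} (h : ExchangeSquare f g f' g') :
    (stepTwoOne x y).map f ≫ (stepTwoOne x y).map g =
      (stepTwoOne x y).map f' ≫ (stepTwoOne x y).map g' :=
  CategoryTheory.Quotient.sound _ (ExchangeGrpd.mk h)

/-- The functor out of a hom-category of the free 2-category extending a map on steps that
respects the exchange relations. -/
def FreeTwo.lift {D : Type*} [Category* D] (φ : P.OneCell x y ⥤q D)
    (hφ : ∀ {p q q' r : P.OneCell x y} {f : P.Step p q} {g : P.Step q r} {f' : P.Step p q'}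
      {g' : P.Step q' r}, ExchangeSquare f g f' g' →
        φ.map f ≫ φ.map g = φ.map f' ≫ φ.map g') : P.FreeTwo x y ⥤ D :=
  CategoryTheory.Quotient.lift _ (Paths.lift φ) (by
    have key : ∀ {p q : P.OneCell x y} (f : P.Step p q),
        (Paths.lift φ).map ((Paths.of (P.OneCell x y)).map f) = φ.map f := fun f =>
      Category.id_comp (φ.map f)
    rintro _ _ _ _ ⟨h⟩
    rw [Functor.map_comp, Functor.map_comp, key, key, key, key]
    exact hφ h)

/-- The functor out of a hom-groupoid of the free (2,1)-category extending a map on steps that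
respects the exchange relations. -/
def FreeTwoOne.lift {D : Type*} [Groupoid D] (φ : P.OneCell x y ⥤q D)
    (hφ : ∀ {p q q' r : P.OneCell x y} {f : P.Step p q} {g : P.Step q r} {f' : P.Step p q'}
      {g' : P.Step q' r}, ExchangeSquare f g f' g' →
        φ.map f ≫ φ.map g = φ.map f' ≫ φ.map g') : P.FreeTwoOne x y ⥤ D :=
  CategoryTheory.Quotient.lift _ (Quiver.FreeGroupoid.lift φ) (by
    have key : ∀ {p q : P.OneCell x y} (f : P.Step p q),
        (Quiver.FreeGroupoid.lift φ).map ((Quiver.FreeGroupoid.of (P.OneCell x y)).map f) =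
          φ.map f := fun f => Category.id_comp (φ.map f)
    rintro _ _ _ _ ⟨h⟩
    rw [Functor.map_comp, Functor.map_comp, key, key, key, key]
    exact hφ h)

/-- The canonical functors from the free 2-category to the free (2,1)-category. -/
def toTwoOne (x y : P.Obj) : P.FreeTwo x y ⥤ P.FreeTwoOne x y :=
  FreeTwo.lift (stepTwoOne x y) stepTwoOne_exchange

/-- The context `f ↦ u f v` on 2-cells of the free 2-category. -/
def ctxTwo (u : P.OneCell x a) (v : P.OneCell b y) : P.FreeTwo a b ⥤ P.FreeTwo x y :=
  FreeTwo.lift (ctxStep u v ⋙q stepTwo x y) fun h => stepTwo_exchange (h.ctx u v)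

/-- The context `f ↦ u f v` on 2-cells of the free (2,1)-category. -/
def ctxTwoOne (u : P.OneCell x a) (v : P.OneCell b y) : P.FreeTwoOne a b ⥤ P.FreeTwoOne x y :=
  FreeTwoOne.lift (ctxStep u v ⋙q stepTwoOne x y) fun h => stepTwoOne_exchange (h.ctx u v)

/-- The 2-cell `u f v` of the free 2-category. -/
def TwoCell.ctx (u : P.OneCell x a) {p q : P.OneCell a b} (f : TwoCell p q)
    (v : P.OneCell b y) : TwoCell (u.ctx p v) (u.ctx q v) :=
  (ctxTwo u v).map f

/-- The 2-cell `u f v` of the free (2,1)-category. -/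
def TwoOneCell.ctx (u : P.OneCell x a) {p q : P.OneCell a b} (f : TwoOneCell p q)
    (v : P.OneCell b y) : TwoOneCell (u.ctx p v) (u.ctx q v) :=
  (ctxTwoOne u v).map f

/-- A 2-cell of the free 2-category as a 2-cell of the free (2,1)-category. -/
def TwoCell.toTwoOneCell {p q : P.OneCell x y} (f : TwoCell p q) : TwoOneCell p q :=
  (toTwoOne x y).map f

/-- The 2-cell of the free 2-category given by a rewriting sequence. -/
def RewSeq.toTwoCell {p q : P.OneCell x y} (f : RewSeq p q) : TwoCell p q :=
  (CategoryTheory.Quotient.functor (Exchange x y)).map (X := p) (Y := q) f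

/-- The 2-cell of the free (2,1)-category given by a rewriting sequence. -/
def RewSeq.toTwoOneCell {p q : P.OneCell x y} (f : RewSeq p q) : TwoOneCell p q :=
  f.toTwoCell.toTwoOneCell

/-! ## Globular extensions and coherent presentations -/

/-- A globular extension of the free (2,1)-category on `P`: a set of 3-cells `A : s₂ A ⇛ t₂ A`
whose 2-source and 2-target are parallel 2-cells. -/
structure GlobularExtension (P : TwoPolygraph.{u, v, w}) where
  Cell : Type t
  s₀ : Cell → P.Obj
  t₀ : Cell → P.Obj
  s₁ : ∀ A : Cell, P.OneCell (s₀ A) (t₀ A)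
  t₁ : ∀ A : Cell, P.OneCell (s₀ A) (t₀ A)
  s₂ : ∀ A : Cell, TwoOneCell (s₁ A) (t₁ A)
  t₂ : ∀ A : Cell, TwoOneCell (s₁ A) (t₁ A)

namespace GlobularExtension

/-- The (disjoint) union of two globular extensions. -/
def union (Γ Δ : GlobularExtension.{u, v, w, t} P) : GlobularExtension.{u, v, w, t} P where
  Cell := Γ.Cell ⊕ Δ.Cell
  s₀ := fun | .inl A => Γ.s₀ A | .inr A => Δ.s₀ A
  t₀ := fun | .inl A => Γ.t₀ A | .inr A => Δ.t₀ A
  s₁ := fun | .inl A => Γ.s₁ A | .inr A => Δ.s₁ A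
  t₁ := fun | .inl A => Γ.t₁ A | .inr A => Δ.t₁ A
  s₂ := fun | .inl A => Γ.s₂ A | .inr A => Δ.s₂ A
  t₂ := fun | .inl A => Γ.t₂ A | .inr A => Δ.t₂ A

/-- The congruence on the parallel 2-cells of the free (2,1)-category generated by the 3-cells
of `Γ`: the relation `f ≡ g` of equality with respect to `Γ`. -/
inductive Equal (Γ : GlobularExtension.{u, v, w, t} P) :
    ∀ {x y : P.Obj} {p q : P.OneCell x y}, TwoOneCell p q → TwoOneCell p q → Prop
  | gen (A : Γ.Cell) : Equal Γ (Γ.s₂ A) (Γ.t₂ A)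
  | refl {x y : P.Obj} {p q : P.OneCell x y} (f : TwoOneCell p q) : Equal Γ f f
  | symm {x y : P.Obj} {p q : P.OneCell x y} {f g : TwoOneCell p q} :
      Equal Γ f g → Equal Γ g f
  | trans {x y : P.Obj} {p q : P.OneCell x y} {f g h : TwoOneCell p q} :
      Equal Γ f g → Equal Γ g h → Equal Γ f h
  | comp {x y : P.Obj} {p q r : P.OneCell x y} {f f' : TwoOneCell p q} {g g' : TwoOneCell q r} :
      Equal Γ f f' → Equal Γ g g' → Equal Γ (f ≫ g) (f' ≫ g')
  | ctx {x a b y : P.Obj} {p q : P.OneCell a b} {f g : TwoOneCell p q} (u : P.OneCell x a)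
      (v : P.OneCell b y) : Equal Γ f g → Equal Γ (f.ctx u v) (g.ctx u v)

/-- Formal composites representing the 3-cells of the free (3,1)-category on `(P, Γ)`: generators,
identities, 2-composites, inverses, 1-composites and contexts. Every 3-cell of the free
(3,1)-category is represented by such a composite, and the axioms of (3,1)-categories only identify
composites with the same 2-source and 2-target. -/
inductive ThreeCell (Γ : GlobularExtension.{u, v, w, t} P) :
    ∀ {x y : P.Obj} {p q : P.OneCell x y}, TwoOneCell p q → TwoOneCell p q →
      Type (max u v w t)
  | gen (A : Γ.Cell) : ThreeCell Γ (Γ.s₂ A) (Γ.t₂ A)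
  | id {x y : P.Obj} {p q : P.OneCell x y} (f : TwoOneCell p q) : ThreeCell Γ f f
  | inv {x y : P.Obj} {p q : P.OneCell x y} {f g : TwoOneCell p q} :
      ThreeCell Γ f g → ThreeCell Γ g f
  | comp₂ {x y : P.Obj} {p q : P.OneCell x y} {f g h : TwoOneCell p q} :
      ThreeCell Γ f g → ThreeCell Γ g h → ThreeCell Γ f h
  | comp₁ {x y : P.Obj} {p q r : P.OneCell x y} {f f' : TwoOneCell p q}
      {g g' : TwoOneCell q r} :
      ThreeCell Γ f f' → ThreeCell Γ g g' → ThreeCell Γ (f ≫ g) (f' ≫ g')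
  | ctx {x a b y : P.Obj} {p q : P.OneCell a b} {f g : TwoOneCell p q} (u : P.OneCell x a)
      (v : P.OneCell b y) : ThreeCell Γ f g → ThreeCell Γ (f.ctx u v) (g.ctx u v)

/-- `Γ` is a homotopy basis: for every 2-sphere `(f, g)` of the free (2,1)-category there is a
3-cell from `f` to `g` in the free (3,1)-category. -/
def IsHomotopyBasis (Γ : GlobularExtension.{u, v, w, t} P) : Prop :=
  ∀ (x y : P.Obj) (p q : P.OneCell x y) (f g : TwoOneCell p q), Nonempty (ThreeCell Γ f g)

end GlobularExtension

/-! ## Quasi-convergence -/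

/-- `P` is quasi-terminating: each infinite rewriting path visits some 1-cell infinitely often. -/
def IsQuasiTerminating (P : TwoPolygraph.{u, v, w}) : Prop :=
  ∀ (x y : P.Obj) (p : ℕ → P.OneCell x y), (∀ n, Nonempty (P.Step (p n) (p (n + 1)))) →
    ∃ q, {n | p n = q}.Infinite

/-- `P` is confluent: every branching can be completed by a confluence. -/
def IsConfluent (P : TwoPolygraph.{u, v, w}) : Prop :=
  ∀ (x y : P.Obj) (p q r : P.OneCell x y), RewSeq p q → RewSeq p r →
    ∃ s : P.OneCell x y, Nonempty (RewSeq q s) ∧ Nonempty (RewSeq r s)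

/-- `P` is quasi-convergent. -/
def IsQuasiConvergent (P : TwoPolygraph.{u, v, w}) : Prop :=
  P.IsConfluent ∧ P.IsQuasiTerminating

/-- `p` is a quasi-normal form. -/
def IsQuasiNormalForm (p : P.OneCell x y) : Prop :=
  ∀ q : P.OneCell x y, P.Step p q → Nonempty (RewSeq q p)

/-- `s` is a quasi-normal form map: it chooses a quasi-normal form of each 1-cell, the same one
for congruent 1-cells. -/
structure IsQuasiNormalFormMap (s : ∀ {x y : P.Obj}, P.OneCell x y → P.OneCell x y) : Prop where
  isQuasiNormalForm : ∀ {x y : P.Obj} (p : P.OneCell x y), IsQuasiNormalForm (s p)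
  rewrites : ∀ {x y : P.Obj} (p : P.OneCell x y), Nonempty (RewSeq p (s p))
  eq_of_congruent : ∀ {x y : P.Obj} (p q : P.OneCell x y), Congruent p q → s p = s q

/-- The distance from `p` to `q`: the length of a shortest rewriting sequence from `p` to `q`
(only meant to be used if `p` rewrites into `q`). -/
noncomputable def dist (p q : P.OneCell x y) : ℕ :=
  sInf {n | ∃ f : RewSeq p q, Quiver.Path.length f = n}

/-! ## Labellings and local branchings -/

/-- A labelling of the rewriting steps by elements of `W`. -/
def Labelling (P : TwoPolygraph.{u, v, w}) (W : Type*) :=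
  ∀ ⦃x y : P.Obj⦄ ⦃p q : P.OneCell x y⦄, P.Step p q → W

/-- The labelling to the quasi-normal form associated with the quasi-normal form map `s`. -/
noncomputable def qnfLabelling (s : ∀ {x y : P.Obj}, P.OneCell x y → P.OneCell x y) :
    Labelling P ℕ :=
  fun _ _ _ q _ => dist q (s q)

/-- The set of labels of the steps of a rewriting sequence. -/
def RewSeq.labels {W : Type*} (ψ : Labelling P W) {p : P.OneCell x y} :
    ∀ {q : P.OneCell x y}, RewSeq p q → Set W
  | _, .nil => ∅
  | _, .cons f e => insert (ψ e) (RewSeq.labels ψ f)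

/-- A local branching `(f, g)`. -/
structure LocalBranching (P : TwoPolygraph.{u, v, w}) where
  {x y : P.Obj}
  {src left right : P.OneCell x y}
  f : P.Step src left
  g : P.Step src right

namespace LocalBranching

/-- The local branching `(g, f)`. -/
def swap (B : LocalBranching P) : LocalBranching P := ⟨B.g, B.f⟩

/-- The local branching `(u f v, u g v)`. -/
def ctx (B : LocalBranching P) (u : P.OneCell x B.x) (v : P.OneCell B.y y) : LocalBranching P :=
  ⟨B.f.ctx u v, B.g.ctx u v⟩

/-- A local branching `(f, f)`. -/
def IsAspherical (B : LocalBranching P) : Prop :=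
  ∃ (x y : P.Obj) (p q : P.OneCell x y) (f : P.Step p q), B = ⟨f, f⟩

/-- A local branching `(f v, u g)`, with `f : u ⇒ u'` and `g : v ⇒ v'`. -/
def peiffer {p p' : P.OneCell x y} {q q' : P.OneCell y z} (f : P.Step p p') (g : P.Step q q') :
    LocalBranching P :=
  ⟨f.whiskerRight q, g.whiskerLeft p⟩

/-- Being a Peiffer branching, up to the order of the two steps. -/
def IsPeiffer (B : LocalBranching P) : Prop :=
  ∃ (x y z : P.Obj) (p p' : P.OneCell x y) (q q' : P.OneCell y z) (f : P.Step p p')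
    (g : P.Step q q'), B = peiffer f g ∨ B = (peiffer f g).swap

/-- An overlapping branching. -/
def IsOverlapping (B : LocalBranching P) : Prop := ¬ B.IsAspherical ∧ ¬ B.IsPeiffer

/-- The order `⊑` on local branchings: `(f, g) ⊑ (u f v, u g v)`. -/
def Le (B C : LocalBranching P) : Prop :=
  ∃ (x y : P.Obj) (u : P.OneCell x B.x) (v : P.OneCell B.y y), C = B.ctx u v

/-- A critical branching: an overlapping branching that is minimal for `⊑`. -/
def IsCritical (B : LocalBranching P) : Prop :=
  B.IsOverlapping ∧ ∀ C : LocalBranching P, C.Le B → C = B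

/-- A confluence `(f', g')` completing a local branching `(f, g)` into a confluence diagram. -/
structure Completion (B : LocalBranching P) where
  {tgt : P.OneCell B.x B.y}
  f' : RewSeq B.left tgt
  g' : RewSeq B.right tgt

/-- The confluence diagram `(u f v ⋅ u f' v, u g v ⋅ u g' v)`. -/
def Completion.ctx {B : LocalBranching P} (D : B.Completion) (u : P.OneCell x B.x)
    (v : P.OneCell B.y y) : (B.ctx u v).Completion :=
  ⟨D.f'.ctx u v, D.g'.ctx u v⟩

/-- The confluence diagram `(f ⋅ f', g ⋅ g')` is strictly decreasing. -/
def Completion.IsStrictlyDecreasing {B : LocalBranching P} (D : B.Completion) {W : Type*} [LT W]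
    (ψ : Labelling P W) : Prop :=
  (∀ k ∈ D.f'.labels ψ, k < ψ B.f) ∧ (∀ k ∈ D.g'.labels ψ, k < ψ B.g)

end LocalBranching

namespace Labelling

variable {W : Type*} [LT W]

/-- `ψ` is compatible with contexts (in the strictly decreasing sense): contexts preserve strictly
decreasing confluence diagrams of local branchings. -/
def IsCompatibleWithContexts (ψ : Labelling P W) : Prop :=
  ∀ (B : LocalBranching P) (D : B.Completion), D.IsStrictlyDecreasing ψ →
    ∀ (x y : P.Obj) (u : P.OneCell x B.x) (v : P.OneCell B.y y),
      (D.ctx u v).IsStrictlyDecreasing ψ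

/-- `(P, ψ)` is Peiffer decreasing (in the strictly decreasing sense) with respect to `Γ`: each
Peiffer branching `(f v, u g)` has a strictly decreasing confluence diagram
`(f v ⋅ f', u g ⋅ g')` with `u' g ⋆₁ (f v')⁻ ≡ f' ⋆₁ g'⁻` with respect to `Γ`. -/
def IsPeifferDecreasing (ψ : Labelling P W) (Γ : GlobularExtension.{u, v, w, t} P) : Prop :=
  ∀ (x y z : P.Obj) (p p' : P.OneCell x y) (q q' : P.OneCell y z) (f : P.Step p p')
    (g : P.Step q q'), ∃ D : (LocalBranching.peiffer f g).Completion,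
      D.IsStrictlyDecreasing ψ ∧
        Γ.Equal
          ((stepTwoOne x z).map (g.whiskerLeft p') ≫
            Groupoid.inv ((stepTwoOne x z).map (f.whiskerRight q')))
          (D.f'.toTwoOneCell ≫ Groupoid.inv D.g'.toTwoOneCell)

end Labelling

/-! ## Loops -/

/-- A 2-loop of the free 2-category. -/
structure Loop (P : TwoPolygraph.{u, v, w}) where
  {x y : P.Obj}
  {base : P.OneCell x y}
  cell : TwoCell base base

namespace Loop

/-- `g` is obtained from `f` by a circular permutation of the steps in some decomposition of `f`
into rewriting steps: the steps of `a` are moved behind those of `b`. -/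
inductive Rotation : Loop P → Loop P → Prop
  | mk {x y : P.Obj} {p q : P.OneCell x y} (a : RewSeq p q) (b : RewSeq q p) :
      Rotation ⟨RewSeq.toTwoCell (a.comp b)⟩ ⟨RewSeq.toTwoCell (b.comp a)⟩

/-- The equivalence of 2-loops (the equivalence relation generated by circular permutations). -/
def equivalence (P : TwoPolygraph.{u, v, w}) : Setoid (Loop P) := Relation.EqvGen.setoid Rotation

/-- A 2-loop `f` is minimal with respect to 1-composition: `f = g ⋆₁ h ⋆₁ k` with `h` a 2-loop
implies that `h` is an identity or equal to `f`. -/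
def IsMinimalComp (f : Loop P) : Prop :=
  ∀ (q : P.OneCell f.x f.y) (g : TwoCell f.base q) (h : TwoCell q q) (k : TwoCell q f.base),
    f.cell = g ≫ h ≫ k → h = 𝟙 _ ∨ (⟨h⟩ : Loop P) = f

/-- The 2-loop `u f v`. -/
def ctx (f : Loop P) (u : P.OneCell x f.x) (v : P.OneCell f.y y) : Loop P := ⟨f.cell.ctx u v⟩

/-- A 2-loop `f` is minimal by context: there is no decomposition `f = u g v` with `g` a 2-loop
and `u`, `v` not both identities. -/
def IsMinimalCtx (f : Loop P) : Prop :=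
  ∀ (g : Loop P) (x y : P.Obj) (u : P.OneCell x g.x) (v : P.OneCell g.y y),
    f = g.ctx u v → u.IsIdentity ∧ v.IsIdentity

/-- An elementary 2-loop. -/
def IsElementary (f : Loop P) : Prop := f.IsMinimalComp ∧ f.IsMinimalCtx

/-- The equivalence classes of elementary 2-loops. -/
def ElementaryClass (P : TwoPolygraph.{u, v, w}) : Type (max u v w) :=
  {c : Quotient (Loop.equivalence P) // ∃ f : Loop P, f.IsElementary ∧ Quotient.mk _ f = c}

end Loop

/-! ## The strictly decreasing Squier completions -/

/-- The choice of one elementary 2-loop in each equivalence class of elementary 2-loops. -/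
structure LoopChoice (P : TwoPolygraph.{u, v, w}) where
  rep : Loop.ElementaryClass P → Loop P
  isElementary : ∀ c, (rep c).IsElementary
  mk_rep : ∀ c, Quotient.mk (Loop.equivalence P) (rep c) = c.1

/-- The loop extension: one 3-cell `α ⇛ 1` for each chosen elementary 2-loop `α`. -/
def LoopChoice.extension (L : LoopChoice P) : GlobularExtension.{u, v, w, max u v w} P where
  Cell := Loop.ElementaryClass P
  s₀ c := (L.rep c).x
  t₀ c := (L.rep c).y
  s₁ c := (L.rep c).base
  t₁ c := (L.rep c).base
  s₂ c := (L.rep c).cell.toTwoOneCell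
  t₂ _ := 𝟙 _

/-- The choice of a strictly decreasing confluence diagram for each critical branching. A critical
branching `(f, g)` may be represented by `(f, g)` or by `(g, f)`. -/
structure StrictConfluenceChoice {W : Type*} [LT W] (ψ : Labelling P W) where
  branchings : Set (LocalBranching P)
  isCritical : ∀ B ∈ branchings, B.IsCritical
  covers : ∀ B : LocalBranching P, B.IsCritical → B ∈ branchings ∨ B.swap ∈ branchings
  diagram : ∀ B : branchings, B.1.Completion
  isStrictlyDecreasing : ∀ B, (diagram B).IsStrictlyDecreasing ψ

/-- The family of generating strictly decreasing confluences: one 3-cell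
`f ⋆₁ f' ⇛ g ⋆₁ g'` for each chosen confluence diagram. -/
def StrictConfluenceChoice.extension {W : Type*} [LT W] {ψ : Labelling P W}
    (O : StrictConfluenceChoice ψ) : GlobularExtension.{u, v, w, max u v w} P where
  Cell := O.branchings
  s₀ B := B.1.x
  t₀ B := B.1.y
  s₁ B := B.1.src
  t₁ B := (O.diagram B).tgt
  s₂ B := (stepTwoOne _ _).map B.1.f ≫ (O.diagram B).f'.toTwoOneCell
  t₂ B := (stepTwoOne _ _).map B.1.g ≫ (O.diagram B).g'.toTwoOneCell

end TwoPolygraph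

/-- A (3,1)-polygraph: a 2-polygraph with a globular extension of its free (2,1)-category. -/
structure ThreeOnePolygraph where
  base : TwoPolygraph.{u, v, w}
  ext : TwoPolygraph.GlobularExtension.{u, v, w, t} base

/-- A coherent presentation of a category `C`: a (3,1)-polygraph whose underlying 2-polygraph is a
presentation of `C` and whose 3-cells form a homotopy basis. -/
def ThreeOnePolygraph.IsCoherentPresentationOf (Q : ThreeOnePolygraph.{u, v, w, t}) (C : Type*)
    [Category* C] : Prop :=
  Q.base.IsPresentationOf C ∧ Q.ext.IsHomotopyBasis

/-- The data of a strictly decreasing Squier completion of `P` with respect to `ψ`. -/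
structure TwoPolygraph.StrictSquierCompletion {P : TwoPolygraph.{u, v, w}} {W : Type*} [LT W]
    (ψ : TwoPolygraph.Labelling P W) where
  confluences : TwoPolygraph.StrictConfluenceChoice ψ
  loops : TwoPolygraph.LoopChoice P

/-- The strictly decreasing Squier completion, as a (3,1)-polygraph. -/
def TwoPolygraph.StrictSquierCompletion.toThreeOnePolygraph {P : TwoPolygraph.{u, v, w}}
    {W : Type*} [LT W] {ψ : TwoPolygraph.Labelling P W}
    (S : TwoPolygraph.StrictSquierCompletion ψ) :
    ThreeOnePolygraph.{u, v, w, max u v w} where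
  base := P
  ext := S.confluences.extension.union S.loops.extension

namespace TwoPolygraph

open OnePolygraph

variable {P : TwoPolygraph.{u, v, w}} {x y z a b : P.Obj}

/-! ## Rewriting sequences as 2-cells -/

/-! Write `≡` for equality modulo the 3-cells, and for each 1-cell `p` let `σ_p` be a shortest
rewriting sequence from `p` to its quasi-normal form. It suffices that `f ⋆₁ σ_q ≡ σ_p` for each
step `f : p ⇒ q` and any choice of shortest sequences (`Step.isCoherent`). This property passes to
composites and inverses, hence to all 2-cells of the free (2,1)-category; two parallel 2-cells `F`,
`G` then satisfy `F ⋆₁ σ_q ≡ σ_p ≡ G ⋆₁ σ_q`, and `σ_q` cancels.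

The property for `f` is proved by induction on its label `d(q, z)`, where `z` is the common
quasi-normal form. If `σ_p` is empty, then `f ⋆₁ σ_q` is a 2-loop. Otherwise `σ_p = e ⋆₁ τ'`, and
the local branching `(f, e)` is closed by a strictly decreasing diagram, all of whose closing steps
have labels smaller than that of `f` and so are covered by induction.

Two facts feed this argument. Every 2-loop is trivial modulo `≡`, by decomposition into elementary
loops (`Loop.isTrivial_of_isElementary`). Every local branching has a strictly decreasing diagram
with `≡`-equal sides, by reduction to critical and Peiffer branchings
(`HasStrictDiagram.of_isCritical`). -/

theorem TwoCell.exists_rewSeq {p q : P.OneCell x y} (f : TwoCell p q) :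
    ∃ F : RewSeq p q, F.toTwoCell = f :=
  Quot.exists_rep f

theorem RewSeq.toTwoCell_nil (p : P.OneCell x y) :
    RewSeq.toTwoCell (.nil : RewSeq p p) = 𝟙 _ := rfl

theorem RewSeq.toTwoCell_comp {p q r : P.OneCell x y} (f : RewSeq p q) (g : RewSeq q r) :
    RewSeq.toTwoCell (f.comp g) = f.toTwoCell ≫ g.toTwoCell := rfl

theorem RewSeq.toTwoOneCell_nil (p : P.OneCell x y) :
    RewSeq.toTwoOneCell (.nil : RewSeq p p) = 𝟙 _ :=
  (toTwoOne x y).map_id _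

theorem RewSeq.toTwoOneCell_comp {p q r : P.OneCell x y} (f : RewSeq p q) (g : RewSeq q r) :
    RewSeq.toTwoOneCell (f.comp g) = f.toTwoOneCell ≫ g.toTwoOneCell :=
  (toTwoOne x y).map_comp f.toTwoCell g.toTwoCell

theorem RewSeq.toTwoOneCell_toPath {p q : P.OneCell x y} (f : P.Step p q) :
    RewSeq.toTwoOneCell (Quiver.Hom.toPath f) = (stepTwoOne x y).map f :=
  Category.id_comp ((stepTwoOne x y).map f)

theorem RewSeq.toTwoOneCell_cons {p q r : P.OneCell x y} (f : RewSeq p q) (g : P.Step q r) :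
    RewSeq.toTwoOneCell (f.cons g) = f.toTwoOneCell ≫ (stepTwoOne x y).map g :=
  (RewSeq.toTwoOneCell_comp f (Quiver.Hom.toPath g)).trans
    (congrArg _ (RewSeq.toTwoOneCell_toPath g))

theorem ctxTwo_toTwoCell (l : P.OneCell x a) (r : P.OneCell b y) {p q : P.OneCell a b}
    (f : RewSeq p q) : f.toTwoCell.ctx l r = (f.ctx l r).toTwoCell := by
  induction f with
  | nil => exact (ctxTwo l r).map_id _
  | cons f e ih =>
    refine ((ctxTwo l r).map_comp (RewSeq.toTwoCell f) ((stepTwo a b).map e)).trans ?_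
    exact (congrArg₂ (· ≫ ·) ih (Category.id_comp ((stepTwo x y).map (e.ctx l r)))).trans
      (RewSeq.toTwoCell_comp (RewSeq.ctx l f r) (Quiver.Hom.toPath (e.ctx l r))).symm

theorem ctxTwoOne_step (l : P.OneCell x a) (r : P.OneCell b y) {p q : P.OneCell a b}
    (f : P.Step p q) : TwoOneCell.ctx l ((stepTwoOne a b).map f) r =
      (stepTwoOne x y).map (f.ctx l r) :=
  Category.id_comp ((stepTwoOne x y).map (f.ctx l r))

theorem ctxTwoOne_toTwoOneCell (l : P.OneCell x a) (r : P.OneCell b y) {p q : P.OneCell a b}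
    (f : RewSeq p q) : f.toTwoOneCell.ctx l r = (f.ctx l r).toTwoOneCell := by
  induction f with
  | nil =>
    rw [RewSeq.toTwoOneCell_nil]
    exact ((ctxTwoOne l r).map_id _).trans (RewSeq.toTwoOneCell_nil _).symm
  | cons f e ih =>
    rw [RewSeq.toTwoOneCell_cons]
    refine ((ctxTwoOne l r).map_comp (RewSeq.toTwoOneCell f) ((stepTwoOne a b).map e)).trans ?_
    exact (congrArg₂ (· ≫ ·) ih (ctxTwoOne_step l r e)).trans
      (RewSeq.toTwoOneCell_cons (RewSeq.ctx l f r) (e.ctx l r)).symm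

theorem TwoCell.toTwoOneCell_ctx (l : P.OneCell x a) (r : P.OneCell b y) {p q : P.OneCell a b}
    (f : TwoCell p q) : (f.ctx l r).toTwoOneCell = f.toTwoOneCell.ctx l r := by
  obtain ⟨F, rfl⟩ := f.exists_rewSeq
  rw [ctxTwo_toTwoCell]
  exact (ctxTwoOne_toTwoOneCell l r F).symm

/-! ## Lengths -/

/-- The functor counting the rewriting steps of a 2-cell of the free 2-category. -/
def lengthFunctor (x y : P.Obj) : P.FreeTwo x y ⥤ SingleObj (Multiplicative ℕ) :=
  FreeTwo.lift (D := SingleObj (Multiplicative ℕ))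
    -- Both sides of an exchange square consist of two steps, so the count is well defined.
    { obj := fun _ => SingleObj.star _, map := fun _ => Multiplicative.ofAdd 1 } fun _ => rfl

/-- The number of rewriting steps of a 2-cell of the free 2-category. -/
def TwoCell.length {p q : P.OneCell x y} (f : TwoCell p q) : ℕ :=
  Multiplicative.toAdd (α := ℕ) ((lengthFunctor x y).map f)

theorem TwoCell.length_comp {p q r : P.OneCell x y} (f : TwoCell p q) (g : TwoCell q r) :
    TwoCell.length (f ≫ g) = f.length + g.length := by
  have h := (lengthFunctor x y).map_comp f g
  -- Composition in `SingleObj` is multiplication in the reverse order, whence the final `add_comm`.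
  rw [SingleObj.comp_as_mul] at h
  exact (congrArg (Multiplicative.toAdd (α := ℕ)) h).trans
    ((toAdd_mul (α := ℕ) _ _).trans (add_comm _ _))

theorem RewSeq.length_toTwoCell {p q : P.OneCell x y} (f : RewSeq p q) :
    f.toTwoCell.length = Quiver.Path.length f := by
  induction f with
  | nil => rfl
  | cons f e ih =>
    refine (TwoCell.length_comp (RewSeq.toTwoCell f) ((stepTwo x y).map e)).trans ?_
    rw [ih]; rfl

theorem RewSeq.length_ctx (l : P.OneCell x a) (r : P.OneCell b y) {p q : P.OneCell a b}
    (f : RewSeq p q) : Quiver.Path.length (f.ctx l r) = Quiver.Path.length f := by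
  induction f with
  | nil => rfl
  | cons f e ih => exact congrArg (· + 1) ih

theorem TwoCell.length_ctx (l : P.OneCell x a) (r : P.OneCell b y) {p q : P.OneCell a b}
    (f : TwoCell p q) : (f.ctx l r).length = f.length := by
  obtain ⟨F, rfl⟩ := f.exists_rewSeq
  rw [ctxTwo_toTwoCell, RewSeq.length_toTwoCell, RewSeq.length_toTwoCell, RewSeq.length_ctx]

theorem TwoCell.eq_id_of_length_eq_zero {p : P.OneCell x y} (f : TwoCell p p)
    (h : f.length = 0) : f = 𝟙 _ := by
  obtain ⟨F, rfl⟩ := f.exists_rewSeq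
  rw [RewSeq.length_toTwoCell] at h
  rw [Quiver.Path.eq_nil_of_length_zero F h, RewSeq.toTwoCell_nil]

theorem TwoCell.eq_of_length_eq_zero {p q : P.OneCell x y} (f : TwoCell p q)
    (h : f.length = 0) : p = q := by
  obtain ⟨F, rfl⟩ := f.exists_rewSeq
  rw [RewSeq.length_toTwoCell] at h
  exact Quiver.Path.eq_of_length_zero F h

theorem length_oneCell_ctx (l : P.OneCell x a) (p : P.OneCell a b) (r : P.OneCell b y) :
    Quiver.Path.length (l.ctx p r) =
      Quiver.Path.length l + Quiver.Path.length p + Quiver.Path.length r :=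
  (Quiver.Path.length_comp _ _).trans (congrArg (· + _) (Quiver.Path.length_comp _ _))

/-! ## Equality of 2-cells with respect to a globular extension -/

namespace GlobularExtension

variable {Γ : GlobularExtension.{u, v, w, t} P}

theorem Equal.nonempty_threeCell {p q : P.OneCell x y} {f g : TwoOneCell p q}
    (h : Γ.Equal f g) : Nonempty (ThreeCell Γ f g) := by
  induction h with
  | gen A => exact ⟨.gen A⟩
  | refl f => exact ⟨.id f⟩
  | symm _ ih => exact ih.map .inv
  | trans _ _ ih₁ ih₂ => exact ih₁.elim fun a => ih₂.map a.comp₂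
  | comp _ _ ih₁ ih₂ => exact ih₁.elim fun a => ih₂.map a.comp₁
  | ctx l r _ ih => exact ih.map (.ctx l r)

theorem Equal.of_eq {p q : P.OneCell x y} {f g : TwoOneCell p q} (h : f = g) : Γ.Equal f g :=
  h ▸ .refl f

theorem Equal.cancel_right {p q r : P.OneCell x y} {f g : TwoOneCell p q} {h : TwoOneCell q r}
    (e : Γ.Equal (f ≫ h) (g ≫ h)) : Γ.Equal f g := by
  have := e.comp (.refl (Groupoid.inv h))
  rwa [Category.assoc, Category.assoc, Groupoid.comp_inv, Category.comp_id,
    Category.comp_id] at this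

/-- Since `g ⋆₁ f ⋆₁ g ≡ g`, the last factor cancels. This makes triviality of loops invariant under
circular permutation. -/
theorem Equal.comp_eq_id_symm {p q : P.OneCell x y} {f : TwoOneCell p q} {g : TwoOneCell q p}
    (e : Γ.Equal (f ≫ g) (𝟙 _)) : Γ.Equal (g ≫ f) (𝟙 _) := by
  refine Equal.cancel_right (h := g) ?_
  rw [Category.assoc, Category.id_comp]
  exact (Equal.comp (.refl g) e).trans (.of_eq (Category.comp_id g))

/-- Turns the condition of Peiffer decreasingness, which compares the exchange square with the
chosen confluence, into equality of the two sides of the confluence diagram. -/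
theorem Equal.of_square {p q q' r o : P.OneCell x y} {f : TwoOneCell p q}
    {g : TwoOneCell q r} {f' : TwoOneCell p q'} {g' : TwoOneCell q' r} {h : TwoOneCell q o}
    {h' : TwoOneCell q' o} (e : f ≫ g = f' ≫ g')
    (e' : Γ.Equal (g ≫ Groupoid.inv g') (h ≫ Groupoid.inv h')) :
    Γ.Equal (f ≫ h) (f' ≫ h') := by
  refine Equal.cancel_right (h := Groupoid.inv h') ?_
  have e₁ := (Equal.refl f).comp e'
  rw [← Category.assoc, e, Category.assoc, Groupoid.comp_inv, Category.comp_id] at e₁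
  rw [Category.assoc, Category.assoc, Groupoid.comp_inv, Category.comp_id]
  exact e₁.symm

end GlobularExtension

/-! ## Every loop is trivial -/

/-- The 2-loop `f` is equal to an identity with respect to `Γ`. -/
def Loop.IsTrivial (Γ : GlobularExtension.{u, v, w, t} P) (f : Loop P) : Prop :=
  Γ.Equal f.cell.toTwoOneCell (𝟙 _)

variable {Γ : GlobularExtension.{u, v, w, t} P}

theorem Loop.Rotation.isTrivial_iff {f g : Loop P} (h : Rotation f g) :
    f.IsTrivial Γ ↔ g.IsTrivial Γ := by
  obtain ⟨a, b⟩ := h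
  have ha := RewSeq.toTwoOneCell_comp a b
  have hb := RewSeq.toTwoOneCell_comp b a
  unfold RewSeq.toTwoOneCell at ha hb
  unfold IsTrivial
  rw [ha, hb]
  exact ⟨.comp_eq_id_symm, .comp_eq_id_symm⟩

theorem Loop.isTrivial_iff_of_equivalence {f g : Loop P} (h : Loop.equivalence P f g) :
    f.IsTrivial Γ ↔ g.IsTrivial Γ := by
  induction h with
  | rel _ _ h => exact h.isTrivial_iff
  | refl => exact Iff.rfl
  | symm _ _ _ ih => exact ih.symm
  | trans _ _ _ _ _ ih₁ ih₂ => exact ih₁.trans ih₂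

theorem Loop.IsTrivial.ctx {f : Loop P} (h : f.IsTrivial Γ) (l : P.OneCell x f.x)
    (r : P.OneCell f.y y) : (f.ctx l r).IsTrivial Γ :=
  (GlobularExtension.Equal.of_eq (TwoCell.toTwoOneCell_ctx l r f.cell)).trans
    ((GlobularExtension.Equal.ctx l r h).trans (.of_eq ((ctxTwoOne l r).map_id _)))

/-- Lexicographic induction on the number of steps and the length of the base 1-cell. Removing a
context keeps the first and lowers the second; extracting a proper subloop `h` from `g ⋆₁ h ⋆₁ k`
leaves two loops, `h` and `g ⋆₁ k`, with fewer steps. -/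
theorem Loop.isTrivial_of_isElementary (hΓ : ∀ f : Loop P, f.IsElementary → f.IsTrivial Γ)
    (f : Loop P) : f.IsTrivial Γ := by
  obtain ⟨n, hn⟩ : ∃ n, f.cell.length = n := ⟨_, rfl⟩
  obtain ⟨m, hm⟩ : ∃ m, Quiver.Path.length f.base = m := ⟨_, rfl⟩
  induction n using Nat.strong_induction_on generalizing f m with
  | _ n ihn =>
  induction m using Nat.strong_induction_on generalizing f with
  | _ m ihm =>
  by_cases hc : f.IsMinimalComp
  · by_cases hx : f.IsMinimalCtx
    · exact hΓ f ⟨hc, hx⟩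
    · simp only [IsMinimalCtx, not_forall, exists_prop] at hx
      obtain ⟨g, x, y, l, r, rfl, hlr⟩ := hx
      have hb : Quiver.Path.length (g.ctx l r).base = _ := length_oneCell_ctx l g.base r
      have hl : (g.ctx l r).cell.length = g.cell.length := TwoCell.length_ctx l r g.cell
      unfold OneCell.IsIdentity at hlr
      exact (ihm _ (by omega) g (hl.symm.trans hn) rfl).ctx l r
  · simp only [IsMinimalComp, not_forall, not_or, exists_prop] at hc
    obtain ⟨q, g, h, k, hf, h1, hne⟩ := hc
    have hlen : f.cell.length = g.length + (h.length + k.length) := by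
      rw [hf]
      exact (TwoCell.length_comp g (h ≫ k)).trans (congrArg _ (TwoCell.length_comp h k))
    have h0 : h.length ≠ 0 := fun h0 => h1 (TwoCell.eq_id_of_length_eq_zero h h0)
    -- If `g` and `k` were both empty, `h` would be the whole loop, which is excluded; hence `h` is
    -- strictly shorter.
    have hgk : g.length + k.length ≠ 0 := by
      intro h0
      obtain ⟨c⟩ := f
      obtain rfl := TwoCell.eq_of_length_eq_zero g (by omega)
      rw [TwoCell.eq_id_of_length_eq_zero g (by omega),
        TwoCell.eq_id_of_length_eq_zero k (by omega)] at hf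
      refine hne ?_
      simp only at hf
      rw [hf]
      congr 1
      exact ((Category.id_comp _).trans (Category.comp_id _)).symm
    have t₁ : Loop.IsTrivial Γ ⟨h⟩ := ihn h.length (by omega) ⟨h⟩ rfl _ rfl
    have t₂ : Loop.IsTrivial Γ ⟨g ≫ k⟩ :=
      ihn (g.length + k.length) (by omega) ⟨g ≫ k⟩ (TwoCell.length_comp g k) _ rfl
    unfold IsTrivial at *
    have e : f.cell.toTwoOneCell = g.toTwoOneCell ≫ h.toTwoOneCell ≫ k.toTwoOneCell := by
      rw [hf]
      exact ((toTwoOne _ _).map_comp g (h ≫ k)).trans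
        (congrArg _ ((toTwoOne _ _).map_comp h k))
    rw [e]
    refine (GlobularExtension.Equal.comp (.refl _) (.comp t₁ (.refl _))).trans ?_
    rw [Category.id_comp]
    exact (GlobularExtension.Equal.of_eq ((toTwoOne _ _).map_comp g k).symm).trans t₂

/-! ## Strictly decreasing confluence diagrams of local branchings -/

/-- The local branching `B` has a strictly decreasing confluence diagram whose two sides are equal
with respect to `Γ`. -/
def LocalBranching.HasStrictDiagram {W : Type*} [LT W] (ψ : Labelling P W)
    (Γ : GlobularExtension.{u, v, w, t} P) (B : LocalBranching P) : Prop :=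
  ∃ D : B.Completion, D.IsStrictlyDecreasing ψ ∧
    Γ.Equal ((stepTwoOne _ _).map B.f ≫ D.f'.toTwoOneCell)
      ((stepTwoOne _ _).map B.g ≫ D.g'.toTwoOneCell)

namespace LocalBranching

variable {W : Type*} [LT W] {ψ : Labelling P W}

theorem HasStrictDiagram.swap {B : LocalBranching P} (h : B.HasStrictDiagram ψ Γ) :
    B.swap.HasStrictDiagram ψ Γ :=
  let ⟨D, hD, e⟩ := h
  ⟨⟨D.g', D.f'⟩, hD.symm, e.symm⟩

theorem HasStrictDiagram.ctx (hψ : ψ.IsCompatibleWithContexts) {B : LocalBranching P}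
    (h : B.HasStrictDiagram ψ Γ) (l : P.OneCell x B.x) (r : P.OneCell B.y y) :
    (B.ctx l r).HasStrictDiagram ψ Γ := by
  obtain ⟨D, hD, e⟩ := h
  refine ⟨D.ctx l r, hψ B D hD x y l r, ?_⟩
  have key : ∀ {p q r' : P.OneCell B.x B.y} (f : P.Step p q) (g : RewSeq q r'),
      TwoOneCell.ctx l ((stepTwoOne _ _).map f ≫ g.toTwoOneCell) r =
        (stepTwoOne _ _).map (f.ctx l r) ≫ (g.ctx l r).toTwoOneCell := fun f g =>
    ((ctxTwoOne l r).map_comp _ _).trans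
      (congrArg₂ (· ≫ ·) (ctxTwoOne_step l r f) (ctxTwoOne_toTwoOneCell l r g))
  exact (GlobularExtension.Equal.of_eq (key B.f D.f').symm).trans
    ((GlobularExtension.Equal.ctx l r e).trans (.of_eq (key B.g D.g')))

theorem HasStrictDiagram.of_isAspherical {B : LocalBranching P} (h : B.IsAspherical) :
    B.HasStrictDiagram ψ Γ := by
  obtain ⟨x, y, p, q, f, rfl⟩ := h
  exact ⟨⟨.nil, .nil⟩, ⟨fun k hk => hk.elim, fun k hk => hk.elim⟩, .refl _⟩

theorem HasStrictDiagram.of_isPeiffer (hψ : ψ.IsPeifferDecreasing Γ) {B : LocalBranching P}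
    (h : B.IsPeiffer) : B.HasStrictDiagram ψ Γ := by
  obtain ⟨x, y, z, p, p', q, q', f, g, h⟩ := h
  have key : (peiffer f g).HasStrictDiagram ψ Γ := by
    obtain ⟨D, hD, e⟩ := hψ x y z p p' q q' f g
    exact ⟨D, hD, .of_square (stepTwoOne_exchange (.mk f g)) e⟩
  rcases h with rfl | rfl
  exacts [key, key.swap]

/-- The left unit law of paths is not definitional, so the steps are compared by `HEq`. -/
theorem ctx_nil (B : LocalBranching P) : B.ctx (OneCell.id B.x) (OneCell.id B.y) = B := by
  obtain ⟨f, g⟩ := B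
  have h : ∀ {x y : P.Obj} (p : P.OneCell x y), (OneCell.id x).ctx p (OneCell.id y) = p :=
    fun p => Quiver.Path.nil_comp p
  have hs : ∀ {x y : P.Obj} {p q : P.OneCell x y} (f : P.Step p q),
      f.ctx (OneCell.id x) (OneCell.id y) ≍ f := fun f =>
    Step.heq_of_data (h _) (h _) _ _ _ (Quiver.Path.nil_comp f.left) rfl f.source_eq f.target_eq
  have hmk : ∀ {x y : P.Obj} {p q r p' q' r' : P.OneCell x y} {f : P.Step p q} {g : P.Step p r}
      {f' : P.Step p' q'} {g' : P.Step p' r'}, p' = p → q' = q → r' = r → f' ≍ f → g' ≍ g →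
      (⟨f', g'⟩ : LocalBranching P) = ⟨f, g⟩ := by
    rintro _ _ _ _ _ _ _ _ _ _ _ _ rfl rfl rfl hf hg
    rw [eq_of_heq hf, eq_of_heq hg]
  exact hmk (h _) (h _) (h _) (hs f) (hs g)

/-- A context that does not lengthen the source consists of two identities and changes nothing.
Hence `⊑` is well founded, with the length of the source as measure. -/
theorem length_src_lt_of_le_of_ne {B C : LocalBranching P} (h : C.Le B) (hne : C ≠ B) :
    Quiver.Path.length C.src < Quiver.Path.length B.src := by
  obtain ⟨x, y, l, r, rfl⟩ := h
  have e : Quiver.Path.length (C.ctx l r).src = _ := length_oneCell_ctx l C.src r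
  by_contra hlt
  have hl : Quiver.Path.length l = 0 := by omega
  have hr : Quiver.Path.length r = 0 := by omega
  obtain rfl := Quiver.Path.eq_of_length_zero l hl
  obtain rfl := Quiver.Path.eq_of_length_zero r hr
  obtain rfl := Quiver.Path.eq_nil_of_length_zero l hl
  obtain rfl := Quiver.Path.eq_nil_of_length_zero r hr
  exact hne C.ctx_nil.symm

/-- An overlapping branching that is not minimal is a context of one with a shorter source, whose
diagram stays strictly decreasing in that context. -/
theorem HasStrictDiagram.of_isCritical (hctx : ψ.IsCompatibleWithContexts)
    (hPeiffer : ψ.IsPeifferDecreasing Γ)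
    (hcrit : ∀ B : LocalBranching P, B.IsCritical → B.HasStrictDiagram ψ Γ)
    (B : LocalBranching P) : B.HasStrictDiagram ψ Γ := by
  obtain ⟨n, hn⟩ : ∃ n, Quiver.Path.length B.src = n := ⟨_, rfl⟩
  induction n using Nat.strong_induction_on generalizing B with
  | _ n ih =>
  by_cases ha : B.IsAspherical
  · exact .of_isAspherical ha
  by_cases hp : B.IsPeiffer
  · exact .of_isPeiffer hPeiffer hp
  by_cases hm : ∀ C : LocalBranching P, C.Le B → C = B
  · exact hcrit B ⟨⟨ha, hp⟩, hm⟩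
  · push Not at hm
    obtain ⟨C, hC, hne⟩ := hm
    have hlt := length_src_lt_of_le_of_ne hC hne
    have hC' := ih _ (hn ▸ hlt) C rfl
    obtain ⟨x, y, l, r, rfl⟩ := hC
    exact hC'.ctx hctx l r

end LocalBranching

/-! ## Distances and quasi-normal forms -/

/-- The rewriting sequence `f` is as short as possible. -/
def RewSeq.IsShortest {p q : P.OneCell x y} (f : RewSeq p q) : Prop :=
  Quiver.Path.length f = dist p q

theorem dist_le_length {p q : P.OneCell x y} (f : RewSeq p q) :
    dist p q ≤ Quiver.Path.length f :=
  Nat.sInf_le ⟨f, rfl⟩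

theorem RewSeq.exists_isShortest {p q : P.OneCell x y} (f : RewSeq p q) :
    ∃ g : RewSeq p q, g.IsShortest :=
  Nat.sInf_mem (s := {n | ∃ f : RewSeq p q, Quiver.Path.length f = n}) ⟨_, f, rfl⟩

/-- The sequence `g` only witnesses that `r` is reachable from `q`; otherwise `dist q r` would be
the junk value `0` of `sInf ∅`. -/
theorem dist_le_succ {p q r : P.OneCell x y} (f : P.Step p q) (g : RewSeq q r) :
    dist p r ≤ dist q r + 1 := by
  obtain ⟨h, hh⟩ := g.exists_isShortest
  have := dist_le_length ((Quiver.Hom.toPath f).comp h)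
  rw [Quiver.Path.length_comp, Quiver.Path.length_toPath] at this
  unfold RewSeq.IsShortest at hh
  omega

theorem Step.congruent {p q : P.OneCell x y} (f : P.Step p q) : Congruent p q := by
  obtain ⟨l, e, r, rfl, rfl⟩ := f
  let F := CategoryTheory.Quotient.functor P.ruleRel
  have key : ∀ m, F.map (X := x) (Y := y) (l.ctx m r) =
      (F.map (X := x) l ≫ F.map m) ≫ F.map (Y := y) r := fun m =>
    (F.map_comp (X := x) (Z := y) (l.comp m) r).trans
      (congrArg (· ≫ _) (F.map_comp (X := x) l m))
  exact (key _).trans ((congrArg (fun m => (_ ≫ m) ≫ _)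
    (CategoryTheory.Quotient.sound P.ruleRel ⟨e⟩)).trans (key _).symm)

variable {s : ∀ {x y : P.Obj}, P.OneCell x y → P.OneCell x y}

theorem IsQuasiNormalFormMap.eq_of_step (hs : IsQuasiNormalFormMap s) {p q : P.OneCell x y}
    (f : P.Step p q) : s p = s q :=
  hs.eq_of_congruent p q f.congruent

theorem IsQuasiNormalFormMap.eq_of_rewSeq (hs : IsQuasiNormalFormMap s) {p q : P.OneCell x y}
    (f : RewSeq p q) : s p = s q := by
  induction f with
  | nil => rfl
  | cons _ e ih => exact ih.trans (hs.eq_of_step e)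

theorem IsQuasiNormalFormMap.exists_isShortest (hs : IsQuasiNormalFormMap s) {p z : P.OneCell x y}
    (h : s p = z) : ∃ f : RewSeq p z, f.IsShortest := by
  subst h
  exact (hs.rewrites p).elim RewSeq.exists_isShortest

/-! ## Shortest rewriting sequences to the quasi-normal form -/

/-- Composing the step `f` with a shortest rewriting sequence to the quasi-normal form yields
a shortest rewriting sequence to the quasi-normal form, up to `Γ`. -/
def Step.IsCoherent (s : ∀ {x y : P.Obj}, P.OneCell x y → P.OneCell x y)
    (Γ : GlobularExtension.{u, v, w, t} P) {p q : P.OneCell x y} (f : P.Step p q) : Prop :=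
  ∀ (z : P.OneCell x y) (σ : RewSeq q z) (τ : RewSeq p z), s q = z → σ.IsShortest →
    τ.IsShortest → Γ.Equal ((stepTwoOne x y).map f ≫ σ.toTwoOneCell) τ.toTwoOneCell

/-- A tail of a shortest sequence is shortest, so its first step lowers the distance by exactly one.
-/
theorem RewSeq.exists_eq_step_comp {p z : P.OneCell x y} {σ : RewSeq p z} (hσ : σ.IsShortest)
    (h : Quiver.Path.length σ ≠ 0) :
    ∃ (q : P.OneCell x y) (e : P.Step p q) (σ' : RewSeq q z), σ'.IsShortest ∧
      dist p z = dist q z + 1 ∧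
      σ.toTwoOneCell = (stepTwoOne x y).map e ≫ σ'.toTwoOneCell := by
  obtain ⟨q, e, σ', rfl, hl⟩ := (Quiver.Path.length_ne_zero_iff_eq_comp σ).1 h
  have h₁ := dist_le_succ e σ'
  have h₂ := dist_le_length σ'
  unfold IsShortest at *
  refine ⟨q, e, σ', by omega, by omega, ?_⟩
  rw [toTwoOneCell_comp]
  exact congrArg (· ≫ _) (toTwoOneCell_toPath e)

/-- The first step `e` of `σ` has label `dist p z - 1 < n`, so coherence of `e` already compares `σ`
with any shortest `τ`. -/
theorem RewSeq.equal_of_isShortest (hs : IsQuasiNormalFormMap s) {n : ℕ}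
    (H : ∀ {x y : P.Obj} {p q : P.OneCell x y} (f : P.Step p q), qnfLabelling s f < n →
      f.IsCoherent s Γ) {p z : P.OneCell x y} (hz : s p = z) (hn : dist p z ≤ n)
    {σ τ : RewSeq p z} (hσ : σ.IsShortest) (hτ : τ.IsShortest) :
    Γ.Equal σ.toTwoOneCell τ.toTwoOneCell := by
  by_cases h : Quiver.Path.length σ = 0
  · have h' : Quiver.Path.length τ = 0 := hτ.trans (hσ.symm.trans h)
    obtain rfl := Quiver.Path.eq_of_length_zero σ h
    rw [Quiver.Path.eq_nil_of_length_zero σ h, Quiver.Path.eq_nil_of_length_zero τ h']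
    exact .refl _
  · obtain ⟨q, e, σ', hσ', hd, e'⟩ := RewSeq.exists_eq_step_comp hσ h
    rw [e']
    have hq : s q = z := (hs.eq_of_step e).symm.trans hz
    have he : qnfLabelling s e = dist q z := congrArg (dist q) hq
    exact H e (by omega) z σ' τ hq hσ' hτ

/-- The steps of `f` are absorbed one at a time, from the last, into the shortest sequence that
follows. The bound on `dist p z` serves only when nothing is left and two shortest sequences from
`p` are compared. -/
theorem RewSeq.comp_equal_of_labels_lt (hs : IsQuasiNormalFormMap s) {n : ℕ}
    (H : ∀ {x y : P.Obj} {p q : P.OneCell x y} (f : P.Step p q), qnfLabelling s f < n →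
      f.IsCoherent s Γ) {p q z : P.OneCell x y} (hz : s p = z) (hn : dist p z ≤ n)
    (f : RewSeq p q) (hf : ∀ k ∈ f.labels (qnfLabelling s), k < n)
    {σ : RewSeq p z} {τ : RewSeq q z} (hσ : σ.IsShortest) (hτ : τ.IsShortest) :
    Γ.Equal (f.toTwoOneCell ≫ τ.toTwoOneCell) σ.toTwoOneCell := by
  induction f with
  | nil =>
    rw [RewSeq.toTwoOneCell_nil, Category.id_comp]
    exact RewSeq.equal_of_isShortest hs H hz hn hτ hσ
  | cons f e ih =>
    have hf' : ∀ k ∈ RewSeq.labels (qnfLabelling s) f, k < n :=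
      fun k hk => hf k (Set.mem_insert_of_mem _ hk)
    obtain ⟨ρ, hρ⟩ := RewSeq.exists_isShortest ((Quiver.Hom.toPath e).comp τ)
    have hr : s _ = z := (hs.eq_of_rewSeq (Quiver.Path.cons f e)).symm.trans hz
    rw [RewSeq.toTwoOneCell_cons, Category.assoc]
    exact (GlobularExtension.Equal.comp (.refl _)
      (H e (hf _ (Set.mem_insert _ _)) z τ ρ hr hτ hρ)).trans (ih hf' hρ)

theorem Step.isCoherent (hs : IsQuasiNormalFormMap s)
    (hloop : ∀ f : Loop P, f.IsTrivial Γ)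
    (hloc : ∀ B : LocalBranching P, B.HasStrictDiagram (qnfLabelling s) Γ)
    {p q : P.OneCell x y} (f : P.Step p q) : f.IsCoherent s Γ := by
  obtain ⟨n, hn⟩ : ∃ n, qnfLabelling s f = n := ⟨_, rfl⟩
  induction n using Nat.strong_induction_on generalizing x y p q f with
  | _ n ih =>
  have H : ∀ {x y : P.Obj} {p q : P.OneCell x y} (f : P.Step p q), qnfLabelling s f < n →
      f.IsCoherent s Γ := fun f hf => ih _ hf f rfl
  intro z σ τ hz hσ hτ
  have hd : dist q z = n := (congrArg (dist q) hz.symm).trans hn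
  by_cases h : Quiver.Path.length τ = 0
  -- Here `p` is its own quasi-normal form, so `f ⋆₁ σ` is a 2-loop. No induction on labels could
  -- handle this case, as `τ` has no first step.
  · obtain rfl := Quiver.Path.eq_of_length_zero τ h
    rw [Quiver.Path.eq_nil_of_length_zero τ h, RewSeq.toTwoOneCell_nil,
      ← RewSeq.toTwoOneCell_toPath, ← RewSeq.toTwoOneCell_comp]
    exact hloop ⟨RewSeq.toTwoCell ((Quiver.Hom.toPath f).comp σ)⟩
  · obtain ⟨r, e, τ', hτ', hd', e'⟩ := RewSeq.exists_eq_step_comp hτ h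
    -- The label of `e` is `dist r z = dist p z - 1 ≤ dist q z = n`. It may equal `n`, but strict
    -- decrease puts the steps of `g'` below `n` all the same.
    have hle := dist_le_succ f σ
    have hr : s r = z := (hs.eq_of_step e).symm.trans ((hs.eq_of_step f).trans hz)
    have hrn : qnfLabelling s e = dist r z := congrArg (dist r) hr
    obtain ⟨⟨f', g'⟩, ⟨hf', hg'⟩, E⟩ := hloc ⟨f, e⟩
    obtain ⟨ρ, hρ⟩ : ∃ ρ : RewSeq _ z, ρ.IsShortest := hs.exists_isShortest 
      ((hs.eq_of_rewSeq f').symm.trans hz)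
    have h₁ := RewSeq.comp_equal_of_labels_lt hs H hz hd.le f'
      (fun k hk => (hf' k hk).trans_eq hn) hσ hρ
    have h₂ := RewSeq.comp_equal_of_labels_lt hs H hr (by omega) g'
      (fun k hk => (hg' k hk).trans_le (by simp only [hrn]; omega)) hτ' hρ
    rw [e']
    -- The chain is `f ⋆₁ σ ≡ f ⋆₁ f' ⋆₁ ρ ≡ e ⋆₁ g' ⋆₁ ρ ≡ e ⋆₁ τ'`.
    refine (GlobularExtension.Equal.comp (.refl _) h₁.symm).trans
      (.trans ?_ (GlobularExtension.Equal.comp (.refl _) h₂))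
    rw [← Category.assoc, ← Category.assoc]
    exact E.comp (.refl _)

/-! ## Coherence -/

/-- Composing the 2-cell `F` with a shortest rewriting sequence to the quasi-normal form yields
a shortest rewriting sequence to the quasi-normal form, up to `Γ`. -/
def TwoOneCell.IsCoherent (s : ∀ {x y : P.Obj}, P.OneCell x y → P.OneCell x y)
    (Γ : GlobularExtension.{u, v, w, t} P) {p q : P.OneCell x y} (F : TwoOneCell p q) : Prop :=
  s p = s q ∧ ∀ (z : P.OneCell x y) (σ : RewSeq q z) (τ : RewSeq p z), s q = z → σ.IsShortest →
    τ.IsShortest → Γ.Equal (F ≫ σ.toTwoOneCell) τ.toTwoOneCell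

namespace TwoOneCell.IsCoherent

theorem comp (hs : IsQuasiNormalFormMap s) {p q r : P.OneCell x y} {F : TwoOneCell p q}
    {G : TwoOneCell q r} (hF : F.IsCoherent s Γ) (hG : G.IsCoherent s Γ) :
    TwoOneCell.IsCoherent s Γ (F ≫ G) := by
  refine ⟨hF.1.trans hG.1, fun z σ τ hz hσ hτ => ?_⟩
  obtain ⟨ρ, hρ⟩ := hs.exists_isShortest (hG.1.trans hz)
  rw [Category.assoc]
  exact (GlobularExtension.Equal.comp (.refl _) (hG.2 z σ ρ hz hσ hρ)).trans
    (hF.2 z ρ τ (hG.1.trans hz) hρ hτ)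

theorem inv {p q : P.OneCell x y} {F : TwoOneCell p q} (hF : F.IsCoherent s Γ) :
    TwoOneCell.IsCoherent s Γ (Groupoid.inv F) := by
  refine ⟨hF.1.symm, fun z σ τ hz hσ hτ => ?_⟩
  have h := GlobularExtension.Equal.comp (.refl (Groupoid.inv F))
    (hF.2 z τ σ (hF.1.symm.trans hz) hτ hσ)
  rw [← Category.assoc, Groupoid.inv_comp, Category.id_comp] at h
  exact h.symm

theorem equal {p q : P.OneCell x y} (hs : IsQuasiNormalFormMap s) {F G : TwoOneCell p q}
    (hF : F.IsCoherent s Γ) (hG : G.IsCoherent s Γ) : Γ.Equal F G := by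
  obtain ⟨σ, hσ⟩ := hs.exists_isShortest (p := q) rfl
  obtain ⟨τ, hτ⟩ := hs.exists_isShortest hF.1
  exact ((hF.2 _ σ τ rfl hσ hτ).trans (hG.2 _ σ τ rfl hσ hτ).symm).cancel_right

end TwoOneCell.IsCoherent

/-- Induction principle for the 2-cells of the free (2,1)-category. -/
theorem TwoOneCell.induction {motive : ∀ {p q : P.OneCell x y}, TwoOneCell p q → Prop}
    (id : ∀ p : P.OneCell x y, motive (𝟙 ((stepTwoOne x y).obj p)))
    (comp : ∀ {p q r : P.OneCell x y} (F : TwoOneCell p q) (G : TwoOneCell q r),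
      motive F → motive G → motive (F ≫ G))
    (step : ∀ {p q : P.OneCell x y} (f : P.Step p q), motive ((stepTwoOne x y).map f))
    (inv : ∀ {p q : P.OneCell x y} (F : TwoOneCell p q), motive F → motive (Groupoid.inv F))
    {p q : P.OneCell x y} (F : TwoOneCell p q) : motive F := by
  have key : ∀ {p q : P.OneCell x y} (F : Quiver.Path (V := Quiver.Symmetrify (P.OneCell x y)) p q),
      motive (p := p) (q := q) ((CategoryTheory.Quotient.functor (ExchangeGrpd x y)).map
        ((CategoryTheory.Quotient.functor (Quiver.FreeGroupoid.redStep (V := P.OneCell x y))).map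
          (X := p) (Y := q) F)) := by
    intro p q F
    induction F with
    | nil => exact id p
    | cons F e ih =>
      rcases e with e | e
      · exact comp _ _ ih (step e)
      · exact comp _ _ ih (inv _ (step e))
  -- Two quotients are unwound, by the exchange relations and by the free groupoid reductions; a
  -- zigzag of steps remains.
  obtain ⟨F, rfl⟩ := Quot.exists_rep F
  obtain ⟨F, rfl⟩ := Quot.exists_rep F
  exact key F

theorem GlobularExtension.isHomotopyBasis_of_isCoherent (hs : IsQuasiNormalFormMap s)
    (H : ∀ {x y : P.Obj} {p q : P.OneCell x y} (f : P.Step p q), f.IsCoherent s Γ) :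
    Γ.IsHomotopyBasis := by
  have key : ∀ {x y : P.Obj} {p q : P.OneCell x y} (F : TwoOneCell p q), F.IsCoherent s Γ := by
    intro x y p q F
    induction F using TwoOneCell.induction with
    | id p =>
      -- Even for an identity there is something to prove: `σ` and `τ` may be different shortest
      -- sequences.
      refine ⟨rfl, fun z σ τ hz hσ hτ => ?_⟩
      rw [Category.id_comp]
      exact RewSeq.equal_of_isShortest hs (n := dist p z) (fun f _ => H f) hz le_rfl hσ hτ
    | comp F G hF hG => exact hF.comp hs hG
    | step f => exact ⟨hs.eq_of_step f, H f⟩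
    | inv F hF => exact hF.inv
  exact fun x y p q F G => ((key F).equal hs (key G)).nonempty_threeCell

/-! ### The 3-cells of the completion -/

namespace StrictSquierCompletion

variable {W : Type*} [LT W] {ψ : Labelling P W} (S : StrictSquierCompletion ψ)

theorem hasStrictDiagram_of_isCritical (B : LocalBranching P) (hB : B.IsCritical) :
    B.HasStrictDiagram ψ S.toThreeOnePolygraph.ext := by
  have key : ∀ B ∈ S.confluences.branchings, B.HasStrictDiagram ψ S.toThreeOnePolygraph.ext :=
    fun B hB => ⟨S.confluences.diagram ⟨B, hB⟩, S.confluences.isStrictlyDecreasing ⟨B, hB⟩,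
      .gen (Γ := S.toThreeOnePolygraph.ext) (.inl ⟨B, hB⟩)⟩
  rcases S.confluences.covers B hB with h | h
  exacts [key B h, (key B.swap h).swap]

/-- A 3-cell kills the chosen representative of the class of `f`, and triviality is invariant under
equivalence of loops. -/
theorem isTrivial_of_isElementary (f : Loop P) (hf : f.IsElementary) :
    f.IsTrivial S.toThreeOnePolygraph.ext := by
  let c : Loop.ElementaryClass P := ⟨Quotient.mk _ f, f, hf, rfl⟩
  have h : (S.loops.rep c).IsTrivial S.toThreeOnePolygraph.ext :=
    .gen (Γ := S.toThreeOnePolygraph.ext) (.inr c)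
  exact (Loop.isTrivial_iff_of_equivalence (Quotient.exact (S.loops.mk_rep c))).1 h

end StrictSquierCompletion

end TwoPolygraph

theorem mainTheorem2 (P : TwoPolygraph.{u, v, w}) (hP : P.IsQuasiConvergent)
    (s : ∀ {x y : P.Obj}, P.OneCell x y → P.OneCell x y)
    (hs : TwoPolygraph.IsQuasiNormalFormMap s)
    (S : TwoPolygraph.StrictSquierCompletion (TwoPolygraph.qnfLabelling s))
    (hctx : (TwoPolygraph.qnfLabelling s).IsCompatibleWithContexts)
    (hPeiffer : (TwoPolygraph.qnfLabelling s).IsPeifferDecreasing S.toThreeOnePolygraph.ext) :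
    S.toThreeOnePolygraph.IsCoherentPresentationOf P.PresentedCategory := by
  -- The underlying 2-polygraph is `P` itself, so identity functors give the presentation.
  refine ⟨⟨𝟭 _, 𝟭 _, rfl, rfl⟩, ?_⟩
  refine TwoPolygraph.GlobularExtension.isHomotopyBasis_of_isCoherent hs fun f => ?_
  exact f.isCoherent hs (TwoPolygraph.Loop.isTrivial_of_isElementary S.isTrivial_of_isElementary)
    (.of_isCritical hctx hPeiffer S.hasStrictDiagram_of_isCritical)
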